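/- **Notation.** For $s\in\mathbb C$ and a positive integer $n$ put $\sigma_s(n)=\sum_{d\mid n}d^{s}$. For positive integers $a,k$ put $$\sigma_{s}(a;k)=\prod_{j=0}^{a-2}\frac{\sigma_{s}\big(k\prod_{p\mid k}p^{j}\big)}{\sigma_{s}\big(\prod_{p\mid k}p^{j}\big)}\quad(\text{equal to }1\text{ at }a=1),\qquad \sigma_s(a_1,\dots,a_r;k)=\prod_{i=1}^r\sigma_s(a_i;k),$$ where $p$ runs over primes, and put $$\zeta(b;\gamma)_\infty=\prod_{k=0}^{\infty}\zeta\big((b+k)\gamma\big),\qquad \zeta(b_1,\dots,b_r;\gamma)_\infty=\prod_{i=1}^r\zeta(b_i;\gamma)_\infty .$$ For a positive integer $m$ let $S_m$ be the set of positive integers all of whose prime factors divide $m$ (so $1\in S_m$). Let $a$ be a positive integer and $\gamma\in\mathbb C$. **Corollary** (some cases of the Dirichlet series analogue of Dixon's sum). All sums below converge absolutely and all infinite products below converge unconditionally. (1) If $a\ge 2$ and $(a-1)\,\mathrm{Re}\,\gamma>1$, then $$\sum_{k=1}^{\infty}\frac{\sigma_{-\gamma}(2a,1,1;k)\,\sigma_{-2\gamma}(1+a;k)\,\sigma_{-\gamma}(a;k)}{\sigma_{-\gamma}(2a,2a;k)\,\sigma_{-2\gamma}(a;k)\,\sigma_{-\gamma}(1+a;k)\,k^{(a-1)\gamma}}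 =\frac{\zeta(2a,2a,a+1,a-1;\gamma)_\infty}{\zeta(2a+1,a,a,2a-1;\gamma)_\infty} =\frac{\zeta(2a\gamma)\,\zeta((a-1)\gamma)}{\zeta(a\gamma)\,\zeta((2a-1)\gamma)}.$$ (2) If $a\ge 2$, $\mathrm{Re}\,\gamma\ne 0$ and $m\ge 1$, then $$\sum_{k\in S_m}\frac{\sigma_{-\gamma}(2a,1,1;k)\,\sigma_{-2\gamma}(1+a;k)\,\sigma_{-\gamma}(a;k)}{\sigma_{-\gamma}(2a,2a;k)\,\sigma_{-2\gamma}(a;k)\,\sigma_{-\gamma}(1+a;k)\,k^{(a-1)\gamma}} =\frac{\sigma_{-\gamma}\big(\prod_{p\mid m}p^{a-1}\big)\,\sigma_{-\gamma}\big(\prod_{p\mid m}p^{2a-2}\big)}{\sigma_{-\gamma}\big(\prod_{p\mid m}p^{2a-1}\big)\,\sigma_{-\gamma}\big(\prod_{p\mid m}p^{a-2}\big)}.$$ (3) If $a\ge 4$ and $(a-3)\,\mathrm{Re}\,\gamma>1$, then $$\sum_{k=1}^{\infty}\frac{\sigma_{-\gamma}(2a,2,2;k)\,\sigma_{-2\gamma}(1+a;k)\,\sigma_{-\gamma}(a;k)}{\sigma_{-\gamma}(2a-1,2a-1;k)\,\sigma_{-2\gamma}(a;k)\,\sigma_{-\gamma}(1+a;k)\,k^{(a-3)\gamma}}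 =\frac{\zeta(2a-1,2a-1,a+1,a-3;\gamma)_\infty}{\zeta(2a+1,a-1,a-1,2a-3;\gamma)_\infty} =\frac{\zeta((2a-1)\gamma)\,\zeta(2a\gamma)\,\zeta((a-3)\gamma)\,\zeta((a-2)\gamma)}{\zeta((2a-3)\gamma)\,\zeta((2a-2)\gamma)\,\zeta((a-1)\gamma)\,\zeta(a\gamma)}.$$ (4) If $a\ge 4$, $\mathrm{Re}\,\gamma\ne 0$ and $m\ge 1$, then $$\sum_{k\in S_m}\frac{\sigma_{-\gamma}(2a,2,2;k)\,\sigma_{-2\gamma}(1+a;k)\,\sigma_{-\gamma}(a;k)}{\sigma_{-\gamma}(2a-1,2a-1;k)\,\sigma_{-2\gamma}(a;k)\,\sigma_{-\gamma}(1+a;k)\,k^{(a-3)\gamma}} =\frac{\sigma_{-\gamma}\big(\prod_{p\mid m}p^{2a-4}\big)\,\sigma_{-\gamma}\big(\prod_{p\mid m}p^{2a-3}\big)\,\sigma_{-\gamma}\big(\prod_{p\mid m}p^{a-2}\big)\,\sigma_{-\gamma}\big(\prod_{p\mid m}p^{a-1}\big)}{\sigma_{-\gamma}\big(\prod_{p\mid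 m}p^{2a-2}\big)\,\sigma_{-\gamma}\big(\prod_{p\mid m}p^{2a-1}\big)\,\sigma_{-\gamma}\big(\prod_{p\mid m}p^{a-4}\big)\,\sigma_{-\gamma}\big(\prod_{p\mid m}p^{a-3}\big)}.$$ -/

import Mathlib

/-- The divisor function `σ_s(n) = ∑_{d ∣ n} d ^ s` with a complex exponent `s`. -/
noncomputable def sigmaC (s : ℂ) (n : ℕ) : ℂ :=
  ∑ d ∈ n.divisors, (d : ℂ) ^ s

/-- `∏_{p ∣ k} p ^ j`, the product over the primes dividing `k`. -/
def primePow (k j : ℕ) : ℕ :=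
  ∏ p ∈ k.primeFactors, p ^ j

/-- The generalized divisor function
`σ_s(a; k) = ∏_{j=0}^{a-2} σ_s(k ∏_{p ∣ k} p ^ j) / σ_s(∏_{p ∣ k} p ^ j)` for `a ≥ 1`;
it is `1` at `a = 1`. -/
noncomputable def genSigma (s : ℂ) (a k : ℕ) : ℂ :=
  ∏ j ∈ Finset.range (a - 1), sigmaC s (k * primePow k j) / sigmaC s (primePow k j)

/-- `σ_s(a₁, …, a_r; k) = σ_s(a₁; k) ⋯ σ_s(a_r; k)`. -/
noncomputable def genSigmaList (s : ℂ) (as : List ℕ) (k : ℕ) : ℂ :=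
  (as.map fun a => genSigma s a k).prod

/-- `ζ(b; γ)_∞ = ∏_{k=0}^∞ ζ((b + k) γ)`. -/
noncomputable def zetaInf (γ b : ℂ) : ℂ :=
  ∏' k : ℕ, riemannZeta ((b + k) * γ)

/-- `ζ(b₁, …, b_r; γ)_∞ = ζ(b₁; γ)_∞ ⋯ ζ(b_r; γ)_∞`. -/
noncomputable def zetaInfList (γ : ℂ) (bs : List ℂ) : ℂ :=
  (bs.map fun b => zetaInf γ b).prod

/-- `S_m`: the positive integers all of whose prime factors are prime factors of `m`. -/
def primeSupported (m : ℕ) : Set ℕ :=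
  Nat.factoredNumbers m.primeFactors

/-!
Every summand is a multiplicative function of `k`, so each sum is the product of its local factors:
over the primes dividing `m` for the sums over `S_m`, and over all primes for the sums over `k ≥ 1`,
once absolute convergence is known.

At a prime `p` put `q = p ^ (-γ)`. Then `σ_{-γ}(c; p ^ n)` is the Gaussian binomial coefficient
`[n + c - 1 choose c - 1]_q` (`genSigma_prime_pow`), and in the quotient of the two `σ_{-2γ}` and
the two adjacent `σ_{-γ}` everything cancels but `(1 + q ^ (n + a)) / (1 + q ^ a)`
(`dixonTerm_prime_pow`). The resulting sum over `n` is a special case of Dixon's `q`-sum which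
telescopes when `b = 1` or `b = 2` (`hasSum_localTerm_one`, `hasSum_localTerm_two`), so no
hypergeometric theory is needed. This settles `‖q‖ < 1`. Both the terms and the values of the local
sums are invariant under `q ↦ q⁻¹` (`localTerm_inv`), which settles `‖q‖ > 1`, that is, the case
`Re γ < 0` of the sums over `S_m`.

For the sums over all `k`, the local terms are bounded by a constant, independent of `p`, times
`‖q‖ ^ ((a + 1 - 2b) n)`; this gives absolute convergence (`summable_norm_dixonTerm`), and the local
values are those of a quotient of values of `ζ`. Finally `ζ(b; γ)_∞ = ζ(b γ) ζ(b + 1; γ)_∞` with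
nonvanishing factors (`zetaInf_eq_mul`, `zetaInf_ne_zero`) reduces the quotients of infinite
products of zeta values to finite ones.
-/

/-! ### Gaussian binomial coefficients -/

/-- The Gaussian binomial coefficient `[n + c choose c]_q`, as the rational function
`∏_{j < c} (1 - q ^ (n + j + 1)) / (1 - q ^ (j + 1))`. It is meant for `‖q‖ ≠ 1`, where no
denominator vanishes. -/
noncomputable def gaussCoeff (q : ℂ) (c n : ℕ) : ℂ :=
  ∏ j ∈ Finset.range c, (1 - q ^ (n + j + 1)) / (1 - q ^ (j + 1))

lemma one_sub_pow_ne_zero {q : ℂ} (hq : ‖q‖ ≠ 1) {n : ℕ} (hn : n ≠ 0) : 1 - q ^ n ≠ 0 := by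
  intro h
  have h1 : ‖q‖ ^ n = 1 := by rw [← norm_pow, ← sub_eq_zero.mp h, norm_one]
  exact hq ((pow_eq_one_iff_of_nonneg (norm_nonneg q) hn).mp h1)

lemma one_add_pow_ne_zero {q : ℂ} (hq : ‖q‖ ≠ 1) {n : ℕ} (hn : n ≠ 0) : 1 + q ^ n ≠ 0 := by
  intro h
  have h1 : ‖q‖ ^ n = 1 := by
    rw [← norm_pow, eq_neg_of_add_eq_zero_right h, norm_neg, norm_one]
  exact hq ((pow_eq_one_iff_of_nonneg (norm_nonneg q) hn).mp h1)

lemma gaussCoeff_ne_zero {q : ℂ} (hq : ‖q‖ ≠ 1) (c n : ℕ) : gaussCoeff q c n ≠ 0 :=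
  Finset.prod_ne_zero_iff.mpr fun j _ =>
    div_ne_zero (one_sub_pow_ne_zero hq (by lia)) (one_sub_pow_ne_zero hq (by lia))

lemma gaussCoeff_zero_right {q : ℂ} (hq : ‖q‖ ≠ 1) (c : ℕ) : gaussCoeff q c 0 = 1 := by
  refine Finset.prod_eq_one fun j _ => ?_
  rw [zero_add, div_self (one_sub_pow_ne_zero hq (by lia))]

lemma gaussCoeff_succ_left (q : ℂ) (c n : ℕ) :
    gaussCoeff q (c + 1) n =
      gaussCoeff q c n * ((1 - q ^ (n + c + 1)) / (1 - q ^ (c + 1))) :=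
  Finset.prod_range_succ _ _

lemma gaussCoeff_succ_right (q : ℂ) (c n : ℕ) :
    gaussCoeff q c (n + 1) * (1 - q ^ (n + 1)) = gaussCoeff q c n * (1 - q ^ (n + c + 1)) := by
  induction c with
  | zero => simp [gaussCoeff]
  | succ c ih =>
    rw [gaussCoeff_succ_left, gaussCoeff_succ_left, mul_right_comm, ih,
      show n + 1 + c + 1 = n + (c + 1) + 1 by ring]
    ring

lemma gaussCoeff_inv {q : ℂ} (hq : q ≠ 0) (c n : ℕ) :
    gaussCoeff q⁻¹ c n = gaussCoeff q c n / q ^ (c * n) := by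
  have key (i j : ℕ) : (1 - q⁻¹ ^ (i + j)) / (1 - q⁻¹ ^ j) =
      (1 - q ^ (i + j)) / (1 - q ^ j) / q ^ i := by
    have h1 : 1 - q⁻¹ ^ (i + j) = -(1 - q ^ (i + j)) / q ^ (i + j) := by
      rw [inv_pow, eq_div_iff (pow_ne_zero _ hq), sub_mul, inv_mul_cancel₀ (pow_ne_zero _ hq)]
      ring
    have h2 : 1 - q⁻¹ ^ j = -(1 - q ^ j) / q ^ j := by
      rw [inv_pow, eq_div_iff (pow_ne_zero _ hq), sub_mul, inv_mul_cancel₀ (pow_ne_zero _ hq)]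
      ring
    rw [h1, h2, pow_add, div_div_div_eq, neg_mul, mul_neg, neg_div_neg_eq, div_div,
      mul_comm (q ^ i * q ^ j), ← mul_assoc, mul_div_mul_right _ _ (pow_ne_zero _ hq)]
  simp only [gaussCoeff, add_assoc, key, Finset.prod_div_distrib, Finset.prod_const,
    Finset.card_range, ← pow_mul]
  rw [mul_comm n c]

lemma norm_one_sub_pow_le {q : ℂ} (hq : ‖q‖ < 1) (n : ℕ) : ‖1 - q ^ n‖ ≤ 2 := by
  refine (norm_sub_le _ _).trans ?_
  rw [norm_one, norm_pow]
  linarith [pow_le_one₀ (norm_nonneg q) hq.le (n := n)]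

lemma norm_pow_le_of_ne_zero {q : ℂ} {r : ℝ} (hr : r < 1) (hq : ‖q‖ ≤ r) {n : ℕ} (hn : n ≠ 0) :
    ‖q ^ n‖ ≤ r := by
  rw [norm_pow]
  exact (pow_le_of_le_one (norm_nonneg q) (hq.trans hr.le) hn).trans hq

lemma norm_one_sub_pow_ge {q : ℂ} {r : ℝ} (hr : r < 1) (hq : ‖q‖ ≤ r) {n : ℕ} (hn : n ≠ 0) :
    1 - r ≤ ‖1 - q ^ n‖ := by
  have := norm_sub_norm_le (1 : ℂ) (q ^ n)
  rw [norm_one] at this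
  linarith [norm_pow_le_of_ne_zero hr hq hn]

lemma norm_one_add_pow_ge {q : ℂ} {r : ℝ} (hr : r < 1) (hq : ‖q‖ ≤ r) {n : ℕ} (hn : n ≠ 0) :
    1 - r ≤ ‖1 + q ^ n‖ := by
  have := norm_sub_norm_le (1 : ℂ) (-q ^ n)
  rw [norm_one, norm_neg, sub_neg_eq_add] at this
  linarith [norm_pow_le_of_ne_zero hr hq hn]

lemma norm_one_sub_div_one_sub_le {q : ℂ} {r : ℝ} (hr : r < 1) (hq : ‖q‖ ≤ r) (m : ℕ) {n : ℕ}
    (hn : n ≠ 0) : ‖(1 - q ^ m) / (1 - q ^ n)‖ ≤ 2 / (1 - r) := by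
  rw [norm_div]
  exact div_le_div₀ zero_le_two (norm_one_sub_pow_le (hq.trans_lt hr) m) (by linarith)
    (norm_one_sub_pow_ge hr hq hn)

lemma norm_gaussCoeff_le {q : ℂ} {r : ℝ} (hr : r < 1) (hq : ‖q‖ ≤ r) (c n : ℕ) :
    ‖gaussCoeff q c n‖ ≤ (2 / (1 - r)) ^ c := by
  rw [gaussCoeff, norm_prod]
  refine (Finset.prod_le_prod (fun _ _ => norm_nonneg _) fun j _ =>
    norm_one_sub_div_one_sub_le hr hq _ j.succ_ne_zero).trans ?_
  rw [Finset.prod_const, Finset.card_range]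

lemma norm_gaussCoeff_inv_le {q : ℂ} {r : ℝ} (hr : r < 1) (hq : ‖q‖ ≤ r) (c n : ℕ) :
    ‖(gaussCoeff q c n)⁻¹‖ ≤ (2 / (1 - r)) ^ c := by
  rw [gaussCoeff, ← Finset.prod_inv_distrib, norm_prod]
  refine (Finset.prod_le_prod (g := fun _ => 2 / (1 - r)) (fun _ _ => norm_nonneg _)
    fun j _ => ?_).trans ?_
  · rw [inv_div]
    exact norm_one_sub_div_one_sub_le hr hq _ (by lia)
  · rw [Finset.prod_const, Finset.card_range]

/-! ### The local sums -/

/-- The term at `p ^ n` of the two Dirichlet series, as a function of `q = p ^ (-γ)`: it is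
`[2a]_n [b]_n² / [2a + 1 - b]_n² * (1 + q ^ (n + a)) / (1 + q ^ a) * q ^ ((a + 1 - 2b) n)` where
`[c]_n = (q ^ c; q)_n / (q; q)_n`. The first series has `b = 1` and the second
`b = 2`; the natural-number subtractions are exact when `0 < b` and `2b ≤ a`. -/
noncomputable def localTerm (q : ℂ) (a b n : ℕ) : ℂ :=
  gaussCoeff q (2 * a - 1) n * gaussCoeff q (b - 1) n ^ 2 * (gaussCoeff q (2 * a - b) n)⁻¹ ^ 2 *
    ((1 + q ^ (n + a)) * (1 + q ^ a)⁻¹) * q ^ ((a + 1 - 2 * b) * n)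

/-- Inverting `q` multiplies the Gaussian binomial coefficients, the quotient
`(1 + q ^ (n + a)) / (1 + q ^ a)` and the last factor by powers of `q ^ n` that cancel. -/
lemma localTerm_inv {q : ℂ} (hq : q ≠ 0) {a b : ℕ} (hb : 0 < b) (hab : 2 * b ≤ a) (n : ℕ) :
    localTerm q⁻¹ a b n = localTerm q a b n := by
  have h1 : (1 + q⁻¹ ^ (n + a)) * (1 + q⁻¹ ^ a)⁻¹ =
      (1 + q ^ (n + a)) * (1 + q ^ a)⁻¹ * (q ^ n)⁻¹ := by
    have e (m : ℕ) : 1 + q⁻¹ ^ m = (1 + q ^ m) * (q ^ m)⁻¹ := by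
      rw [inv_pow, add_mul, mul_inv_cancel₀ (pow_ne_zero _ hq)]; ring
    rw [e, e, mul_inv, inv_inv, pow_add, mul_inv]
    field_simp
  obtain ⟨c, rfl⟩ : ∃ c, b = c + 1 := ⟨b - 1, by lia⟩
  obtain ⟨d, rfl⟩ : ∃ d, a = 2 * (c + 1) + d := ⟨a - 2 * (c + 1), by lia⟩
  simp only [localTerm, gaussCoeff_inv hq, h1]
  rw [show 2 * (2 * (c + 1) + d) - 1 = 4 * c + 3 + 2 * d by lia,
    show c + 1 - 1 = c by lia,
    show 2 * (2 * (c + 1) + d) - (c + 1) = 3 * c + 3 + 2 * d by lia,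
    show 2 * (c + 1) + d + 1 - 2 * (c + 1) = d + 1 by lia]
  have hX : q ^ n ≠ 0 := pow_ne_zero _ hq
  simp only [div_eq_mul_inv, mul_inv, inv_inv, mul_comm _ n, pow_mul q n, inv_pow]
  generalize q ^ n = X at *
  have e : (X ^ (4 * c + 3 + 2 * d))⁻¹ * (X ^ c)⁻¹ ^ 2 * (X ^ (3 * c + 3 + 2 * d)) ^ 2 * X⁻¹ *
      (X ^ (d + 1))⁻¹ = X ^ (d + 1) := by
    field_simp
    ring
  generalize gaussCoeff q (4 * c + 3 + 2 * d) n = g₁, gaussCoeff q c n = g₂,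
    gaussCoeff q (3 * c + 3 + 2 * d) n = g₃,
    (1 + q ^ (n + (2 * (c + 1) + d))) * (1 + q ^ (2 * (c + 1) + d))⁻¹ = g₄
  linear_combination (g₁ * g₂ ^ 2 * g₃⁻¹ ^ 2 * g₄) * e

lemma norm_localTerm_le {q : ℂ} {r : ℝ} (hr : r < 1) (hq : ‖q‖ ≤ r) {a : ℕ} (ha : 0 < a)
    (b n : ℕ) :
    ‖localTerm q a b n‖ ≤
      (2 / (1 - r)) ^ (2 * a - 1) * ((2 / (1 - r)) ^ (b - 1)) ^ 2 *
        ((2 / (1 - r)) ^ (2 * a - b)) ^ 2 * (2 * (1 - r)⁻¹) * ‖q‖ ^ ((a + 1 - 2 * b) * n) := by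
  have hr' : 0 < 1 - r := by linarith
  simp only [localTerm, norm_mul, norm_pow (gaussCoeff _ _ _), norm_pow (gaussCoeff _ _ _)⁻¹,
    norm_pow q]
  gcongr
  · exact norm_gaussCoeff_le hr hq _ _
  · exact norm_gaussCoeff_le hr hq _ _
  · exact norm_gaussCoeff_inv_le hr hq _ _
  · refine (norm_add_le _ _).trans ?_
    rw [norm_one]
    linarith [norm_pow_le_of_ne_zero hr hq (n := n + a) (by lia)]
  · rw [norm_inv]
    exact inv_anti₀ hr' (norm_one_add_pow_ge hr hq ha.ne')

lemma summable_norm_localTerm {q : ℂ} (hq : ‖q‖ < 1) {a b : ℕ} (ha : 0 < a) (hab : 2 * b ≤ a) :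
    Summable fun n => ‖localTerm q a b n‖ := by
  refine Summable.of_nonneg_of_le (fun _ => norm_nonneg _)
    (fun n => norm_localTerm_le hq le_rfl ha b n) (Summable.mul_left _ ?_)
  simp only [pow_mul]
  exact summable_geometric_of_lt_one (by positivity)
    (pow_lt_one₀ (norm_nonneg q) hq (by lia))

/-- A summable series whose terms telescope, `t n = T n - T (n + 1)`, where `T n` is `q ^ n` times
a bounded sequence. -/
lemma hasSum_of_telescoping {q : ℂ} (hq : ‖q‖ < 1) {t T : ℕ → ℂ} {C : ℝ}
    (ht : Summable fun n => ‖t n‖) (htT : ∀ n, t n = T n - T (n + 1))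
    (hT : ∀ n, ‖T n‖ ≤ C * ‖q‖ ^ n) : HasSum t (T 0) := by
  rw [ht.of_norm.hasSum_iff_tendsto_nat]
  have hT0 : Filter.Tendsto T Filter.atTop (nhds 0) := by
    refine squeeze_zero_norm hT ?_
    simpa using (tendsto_pow_atTop_nhds_zero_of_lt_one (norm_nonneg q) hq).const_mul C
  simp only [htT, Finset.sum_range_sub']
  simpa using hT0.const_sub (T 0)

/-- The local sum at `b = 1`. Its partial sums telescope. -/
lemma hasSum_localTerm_one {q : ℂ} (hq : ‖q‖ < 1) {a : ℕ} (ha : 2 ≤ a) :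
    HasSum (localTerm q a 1)
      ((1 - q ^ a) * (1 - q ^ (2 * a - 1)) / ((1 - q ^ (2 * a)) * (1 - q ^ (a - 1)))) := by
  obtain ⟨d, rfl⟩ : ∃ d, a = d + 2 := ⟨a - 2, by lia⟩
  have hq1 := hq.ne
  have hA := one_sub_pow_ne_zero hq1 (n := d + 2) (by lia)
  have hA' := one_add_pow_ne_zero hq1 (n := d + 2) (by lia)
  have hB := one_sub_pow_ne_zero hq1 (n := d + 1) (by lia)
  have hc := one_sub_pow_ne_zero hq1 (n := 2 * d + 3) (by lia)
  have h2a : 1 - q ^ (2 * (d + 2)) = (1 - q ^ (d + 2)) * (1 + q ^ (d + 2)) := by ring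
  -- `gaussCoeff q (2 * a - 2) n` has one factor less than the denominator of the term.
  let T : ℕ → ℂ := fun n => (1 - q ^ (2 * d + 3)) / ((1 + q ^ (d + 2)) * (1 - q ^ (d + 1))) *
    ((gaussCoeff q (2 * d + 2) n)⁻¹ * (q ^ n) ^ (d + 1))
  have hT0 : T 0 = (1 - q ^ (d + 2)) * (1 - q ^ (2 * (d + 2) - 1)) /
      ((1 - q ^ (2 * (d + 2))) * (1 - q ^ (d + 2 - 1))) := by
    simp only [T, gaussCoeff_zero_right hq1, h2a]
    rw [show 2 * (d + 2) - 1 = 2 * d + 3 by lia, show d + 2 - 1 = d + 1 by lia]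
    simp
    field_simp
  rw [← hT0]
  refine hasSum_of_telescoping (T := T) hq
    (C := ‖(1 - q ^ (2 * d + 3)) / ((1 + q ^ (d + 2)) * (1 - q ^ (d + 1)))‖ *
      ((2 / (1 - ‖q‖)) ^ (2 * d + 2)))
    (summable_norm_localTerm hq (by lia) (by lia)) (fun n => ?_) (fun n => ?_)
  · have hg := gaussCoeff_ne_zero hq1 (2 * d + 2) n
    have hg' := gaussCoeff_ne_zero hq1 (2 * d + 2) (n + 1)
    have hs := gaussCoeff_succ_right q (2 * d + 2) n
    have hn1 := one_sub_pow_ne_zero hq1 (n := n + 1) (by lia)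
    have hnc := one_sub_pow_ne_zero hq1 (n := n + (2 * d + 2) + 1) (by lia)
    have hs' : (gaussCoeff q (2 * d + 2) (n + 1))⁻¹ =
        (gaussCoeff q (2 * d + 2) n)⁻¹ * ((1 - q ^ (n + 1)) / (1 - q ^ (n + (2 * d + 2) + 1))) := by
      field_simp
      linear_combination -hs
    simp only [T, hs', localTerm]
    rw [show 2 * (d + 2) - 1 = 2 * d + 2 + 1 by lia, gaussCoeff_succ_left,
      show 1 - 1 = 0 from rfl, show d + 2 + 1 - 2 * 1 = d + 1 by lia]
    rw [show 2 * d + 2 + 1 = 2 * d + 3 by lia] at *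
    simp only [gaussCoeff, Finset.range_zero, Finset.prod_empty] at *
    field_simp
    ring
  · rw [norm_mul, mul_assoc, norm_mul]
    gcongr
    · exact norm_gaussCoeff_inv_le hq le_rfl _ _
    · rw [norm_pow, norm_pow]
      exact pow_le_of_le_one (by positivity) (pow_le_one₀ (norm_nonneg q) hq.le) (by lia)

/-- The local sum at `b = 2`. Its partial sums telescope. -/
lemma hasSum_localTerm_two {q : ℂ} (hq : ‖q‖ < 1) {a : ℕ} (ha : 4 ≤ a) :
    HasSum (localTerm q a 2)
      ((1 - q ^ (2 * a - 3)) * (1 - q ^ (2 * a - 2)) * (1 - q ^ (a - 1)) * (1 - q ^ a) /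
        ((1 - q ^ (2 * a - 1)) * (1 - q ^ (2 * a)) * (1 - q ^ (a - 3)) * (1 - q ^ (a - 2)))) := by
  obtain ⟨d, rfl⟩ : ∃ d, a = d + 4 := ⟨a - 4, by lia⟩
  have hq1 := hq.ne
  have h1 : 1 - q ≠ 0 := by simpa using one_sub_pow_ne_zero hq1 one_ne_zero
  have hA := one_sub_pow_ne_zero hq1 (n := d + 4) (by lia)
  have hA' := one_add_pow_ne_zero hq1 (n := d + 4) (by lia)
  have hB := one_sub_pow_ne_zero hq1 (n := d + 1) (by lia)
  have hB' := one_sub_pow_ne_zero hq1 (n := d + 2) (by lia)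
  have hc := one_sub_pow_ne_zero hq1 (n := 2 * d + 6 + 1) (by lia)
  have h2a : 1 - q ^ (2 * (d + 4)) = (1 - q ^ (d + 4)) * (1 + q ^ (d + 4)) := by ring
  set B := q ^ (d + 1) with hBdef
  have eA : q ^ (d + 4) = B * q ^ 3 := by rw [hBdef]; ring
  have eB' : q ^ (d + 2) = B * q := by rw [hBdef]; ring
  have ec : q ^ (2 * d + 6 + 1) = B ^ 2 * q ^ 5 := by rw [hBdef]; ring
  rw [eA] at hA hA' h2a
  rw [eB'] at hB'
  rw [ec] at hc
  -- With `x = q ^ n` and `B = q ^ (a - 3)`, the sequence `T` below telescopes to the local term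
  -- exactly when `P` solves the following equation, which has a quadratic solution:
  -- `(1 - B²q⁴x) P x - B (1 - q²x) P (q x) = (1 - B)(1 - Bq)(1 - B²q⁵x)(1 - qx)(1 + Bq³x)`.
  let P : ℂ → ℂ := fun x => (1 - B * q) +
    ((B * q ^ 3 - q - B ^ 2 * q ^ 5) * (1 - B) - B * q ^ 2 * (1 - B * q ^ 2)) * x +
      B ^ 2 * q ^ 5 * (1 - B * q) * x ^ 2
  have hP (x : ℂ) : (1 - B ^ 2 * q ^ 4 * x) * P x - B * (1 - q ^ 2 * x) * P (q * x) =
      (1 - B) * (1 - B * q) * (1 - B ^ 2 * q ^ 5 * x) * (1 - q * x) * (1 + B * q ^ 3 * x) := by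
    simp only [P]; ring
  have hP1 : P 1 = (1 - q) * (1 - B ^ 2 * q ^ 3) * (1 - B * q ^ 2) := by
    simp only [P]; ring
  -- `P` is scaled to clear denominators, whence the factors `(1 - B)(1 - Bq)` of `K`.
  let K : ℂ := ((1 - B ^ 2 * q ^ 5) * (1 - q) ^ 2 * (1 + B * q ^ 3) * (1 - B) * (1 - B * q))⁻¹
  let U : ℂ → ℂ := fun x => (1 - B ^ 2 * q ^ 4 * x) * (1 - q * x) * P x
  let T : ℕ → ℂ := fun n => K * ((gaussCoeff q (2 * d + 6) n)⁻¹ * U (q ^ n) * (q ^ n) ^ (d + 1))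
  have hT0 : T 0 = (1 - q ^ (2 * (d + 4) - 3)) * (1 - q ^ (2 * (d + 4) - 2)) *
      (1 - q ^ (d + 4 - 1)) * (1 - q ^ (d + 4)) /
        ((1 - q ^ (2 * (d + 4) - 1)) * (1 - q ^ (2 * (d + 4))) * (1 - q ^ (d + 4 - 3)) *
          (1 - q ^ (d + 4 - 2))) := by
    rw [show 2 * (d + 4) - 3 = 2 * d + 5 by lia, show 2 * (d + 4) - 2 = 2 * d + 6 by lia,
      show d + 4 - 1 = d + 3 by lia, show 2 * (d + 4) - 1 = 2 * d + 6 + 1 by lia,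
      show d + 4 - 3 = d + 1 by lia, show d + 4 - 2 = d + 2 by lia, h2a, eA, ec, ← hBdef, eB',
      show q ^ (2 * d + 5) = B ^ 2 * q ^ 3 by rw [hBdef]; ring,
      show q ^ (2 * d + 6) = B ^ 2 * q ^ 4 by rw [hBdef]; ring,
      show q ^ (d + 3) = B * q ^ 2 by rw [hBdef]; ring]
    simp only [T, U, K, gaussCoeff_zero_right hq1, pow_zero, hP1, one_pow, mul_one, inv_one,
      one_mul]
    field_simp
  rw [← hT0]
  have hU : ∃ C, ∀ n : ℕ, ‖U (q ^ n)‖ ≤ C := by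
    have hcont : Continuous U := by simp only [U, P]; fun_prop
    obtain ⟨C, hC⟩ := (isCompact_closedBall (0 : ℂ) 1).exists_bound_of_continuousOn
      hcont.continuousOn
    refine ⟨C, fun n => hC _ ?_⟩
    rw [mem_closedBall_zero_iff, norm_pow]
    exact pow_le_one₀ (norm_nonneg q) hq.le
  obtain ⟨C, hC⟩ := hU
  have hC0 : 0 ≤ C := (norm_nonneg _).trans (hC 0)
  refine hasSum_of_telescoping (T := T) hq
    (C := ‖K‖ * ((2 / (1 - ‖q‖)) ^ (2 * d + 6) * C))
    (summable_norm_localTerm hq (by lia) (by lia)) (fun n => ?_) (fun n => ?_)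
  · have hg := gaussCoeff_ne_zero hq1 (2 * d + 6) n
    have hg' := gaussCoeff_ne_zero hq1 (2 * d + 6) (n + 1)
    have hs := gaussCoeff_succ_right q (2 * d + 6) n
    have hn1 := one_sub_pow_ne_zero hq1 (n := n + 1) (by lia)
    have hnc := one_sub_pow_ne_zero hq1 (n := n + (2 * d + 6) + 1) (by lia)
    have enc : q ^ (n + (2 * d + 6) + 1) = B ^ 2 * q ^ 5 * q ^ n := by rw [hBdef]; ring
    have hs' : (gaussCoeff q (2 * d + 6) (n + 1))⁻¹ = (gaussCoeff q (2 * d + 6) n)⁻¹ *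
        ((1 - q * q ^ n) / (1 - B ^ 2 * q ^ 5 * q ^ n)) := by
      rw [← enc, ← pow_succ']
      field_simp
      linear_combination -hs
    rw [enc] at hnc
    have e1 : gaussCoeff q 1 n = (1 - q * q ^ n) / (1 - q) := by
      simp [gaussCoeff, pow_succ']
    simp only [T, hs', localTerm]
    rw [show 2 * (d + 4) - 1 = 2 * d + 6 + 1 by lia, gaussCoeff_succ_left,
      show 2 * (d + 4) - 2 = 2 * d + 6 by lia,
      show 2 - 1 = 1 from rfl, show d + 4 + 1 - 2 * 2 = d + 1 by lia, e1, enc, ec, eA,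
      show q ^ (n + (d + 4)) = B * q ^ 3 * q ^ n by rw [hBdef]; ring,
      show q ^ ((d + 1) * n) = (q ^ n) ^ (d + 1) by ring,
      show (q ^ (n + 1)) ^ (d + 1) = B * (q ^ n) ^ (d + 1) by rw [hBdef]; ring,
      pow_succ' q n]
    generalize q ^ n = x at *
    generalize gaussCoeff q (2 * d + 6) n = g at *
    simp only [U, K]
    have := hP x
    rw [← mul_assoc q q, ← pow_two] at *
    clear_value P
    generalize P x = y, P (q * x) = z at *
    clear_value B
    generalize x ^ (d + 1) = w
    clear * - hg hnc hc h1 hA' hB hB' this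
    field_simp
    linear_combination (-(1 - q * x) * w) * this
  · change ‖K * ((gaussCoeff q (2 * d + 6) n)⁻¹ * U (q ^ n) * (q ^ n) ^ (d + 1))‖ ≤ _
    clear_value K U
    rw [norm_mul, norm_mul, norm_mul, mul_assoc ‖K‖]
    gcongr
    · exact norm_gaussCoeff_inv_le hq le_rfl _ _
    · exact hC n
    · rw [norm_pow, norm_pow]
      exact pow_le_of_le_one (by positivity) (pow_le_one₀ (norm_nonneg q) hq.le) (by lia)

/-! ### Multiplicativity and values at prime powers -/

lemma sigmaC_one (s : ℂ) : sigmaC s 1 = 1 := by simp [sigmaC]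

lemma sigmaC_mul (s : ℂ) {m n : ℕ} (h : m.Coprime n) :
    sigmaC s (m * n) = sigmaC s m * sigmaC s n := by
  rw [sigmaC, Nat.divisors_mul, Finset.mul_def, Finset.sum_image h.mul_injOn_divisors,
    Finset.sum_product, sigmaC, sigmaC, Finset.sum_mul_sum]
  simp only [Nat.cast_mul, Complex.natCast_mul_natCast_cpow]

lemma primePow_one (j : ℕ) : primePow 1 j = 1 := by simp [primePow]

lemma primePow_mul {m n : ℕ} (h : m.Coprime n) (j : ℕ) :
    primePow (m * n) j = primePow m j * primePow n j := by
  rw [primePow, h.primeFactors_mul, Finset.prod_union h.disjoint_primeFactors, primePow, primePow]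

lemma primePow_prime_pow {p : ℕ} (hp : p.Prime) {n : ℕ} (hn : n ≠ 0) (j : ℕ) :
    primePow (p ^ n) j = p ^ j := by
  rw [primePow, Nat.primeFactors_prime_pow hn hp, Finset.prod_singleton]

lemma coprime_primePow {m n : ℕ} (h : m.Coprime n) (i j : ℕ) :
    (m * primePow m i).Coprime (n * primePow n j) := by
  have key {m n : ℕ} (h : m.Coprime n) (j : ℕ) : m.Coprime (primePow n j) :=
    Nat.Coprime.prod_right fun p hp =>
      (h.coprime_dvd_right (Nat.dvd_of_mem_primeFactors hp)).pow_right j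
  exact Nat.Coprime.mul_left (h.mul_right (key h j))
    ((key h.symm i).symm.mul_right (key (key h.symm i).symm j))

lemma genSigma_one (s : ℂ) (a : ℕ) : genSigma s a 1 = 1 := by
  simp [genSigma, primePow_one, sigmaC_one]

lemma genSigma_mul (s : ℂ) (a : ℕ) {m n : ℕ} (h : m.Coprime n) :
    genSigma s a (m * n) = genSigma s a m * genSigma s a n := by
  rw [genSigma, genSigma, genSigma, ← Finset.prod_mul_distrib]
  refine Finset.prod_congr rfl fun j _ => ?_
  have h1 := coprime_primePow h j j
  have h2 : (primePow m j).Coprime (primePow n j) :=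
    h1.coprime_dvd_left (dvd_mul_left _ _) |>.coprime_dvd_right (dvd_mul_left _ _)
  rw [primePow_mul h, mul_mul_mul_comm, sigmaC_mul s h1, sigmaC_mul s h2, mul_div_mul_comm]

lemma genSigma_zero (s : ℂ) {a : ℕ} (ha : 2 ≤ a) : genSigma s a 0 = 0 := by
  refine Finset.prod_eq_zero (Finset.mem_range.mpr (show 0 < a - 1 by lia)) ?_
  simp [sigmaC]

lemma norm_prime_cpow_ne_one {p : ℕ} (hp : p.Prime) {s : ℂ} (hs : s.re ≠ 0) :
    ‖(p : ℂ) ^ s‖ ≠ 1 := by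
  rw [Complex.norm_natCast_cpow_of_pos hp.pos]
  rw [← Real.rpow_zero (p : ℝ)]
  exact fun h => hs ((Real.rpow_right_inj (by exact_mod_cast hp.pos)
    (by exact_mod_cast hp.one_lt.ne')).mp h)

lemma sigmaC_prime_pow {p : ℕ} (hp : p.Prime) {s : ℂ} (hs : s.re ≠ 0) (n : ℕ) :
    sigmaC s (p ^ n) = (1 - ((p : ℂ) ^ s) ^ (n + 1)) / (1 - (p : ℂ) ^ s) := by
  have h1 : (p : ℂ) ^ s ≠ 1 := fun h => norm_prime_cpow_ne_one hp hs (by rw [h, norm_one])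
  rw [sigmaC, Nat.sum_divisors_prime_pow hp, ← neg_div_neg_eq, neg_sub, neg_sub, ← geom_sum_eq h1]
  refine Finset.sum_congr rfl fun i _ => ?_
  rw [Nat.cast_pow, ← Complex.natCast_cpow_natCast_mul, ← Complex.cpow_nat_mul]

lemma genSigma_prime_pow {p : ℕ} (hp : p.Prime) {s : ℂ} (hs : s.re ≠ 0) (a n : ℕ) :
    genSigma s a (p ^ n) = gaussCoeff ((p : ℂ) ^ s) (a - 1) n := by
  have hq := norm_prime_cpow_ne_one hp hs
  rcases eq_or_ne n 0 with rfl | hn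
  · rw [pow_zero, genSigma_one, gaussCoeff_zero_right hq]
  · refine Finset.prod_congr rfl fun j _ => ?_
    have h1 : 1 - (p : ℂ) ^ s ≠ 0 := by simpa using one_sub_pow_ne_zero hq one_ne_zero
    rw [primePow_prime_pow hp hn, ← pow_add, sigmaC_prime_pow hp hs, sigmaC_prime_pow hp hs,
      div_div_div_cancel_right₀ h1]

lemma sigmaC_primePow {s : ℂ} (hs : s.re ≠ 0) (m c : ℕ) :
    sigmaC s (primePow m c) =
      ∏ p ∈ m.primeFactors, (1 - ((p : ℂ) ^ s) ^ (c + 1)) / (1 - (p : ℂ) ^ s) := by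
  have key (t : Finset ℕ) (ht : ∀ p ∈ t, p.Prime) : sigmaC s (∏ p ∈ t, p ^ c) =
      ∏ p ∈ t, (1 - ((p : ℂ) ^ s) ^ (c + 1)) / (1 - (p : ℂ) ^ s) := by
    induction t using Finset.induction with
    | empty => simp [sigmaC_one]
    | insert p t hpt ih =>
      have hp := ht p (Finset.mem_insert_self p t)
      have hcop : (p ^ c).Coprime (∏ p ∈ t, p ^ c) := by
        refine Nat.Coprime.prod_right fun l hl => Nat.Coprime.pow c c ?_
        refine (Nat.coprime_primes hp (ht l (Finset.mem_insert_of_mem hl))).mpr ?_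
        rintro rfl
        exact hpt hl
      rw [Finset.prod_insert hpt, Finset.prod_insert hpt, sigmaC_mul s hcop,
        sigmaC_prime_pow hp hs, ih fun l hl => ht l (Finset.mem_insert_of_mem hl)]
  exact key _ fun p hp => Nat.prime_of_mem_primeFactors hp

/-- The general term of the Dirichlet series analogue of Dixon's sum with parameters `a` and `b`.
The first series has `b = 1` and the second `b = 2`; the natural-number subtractions are exact
when `2b ≤ a`. -/
noncomputable def dixonTerm (γ : ℂ) (a b k : ℕ) : ℂ :=
  (genSigmaList (-γ) [2 * a, b, b] k * genSigma (-(2 * γ)) (1 + a) k * genSigma (-γ) a k) /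
    (genSigmaList (-γ) [2 * a + 1 - b, 2 * a + 1 - b] k * genSigma (-(2 * γ)) a k
      * genSigma (-γ) (1 + a) k * (k : ℂ) ^ (((a + 1 - 2 * b : ℕ) : ℂ) * γ))

lemma dixonTerm_zero (γ : ℂ) {a b : ℕ} (ha : 2 ≤ a) : dixonTerm γ a b 0 = 0 := by
  simp [dixonTerm, genSigma_zero _ ha]

lemma dixonTerm_one (γ : ℂ) (a b : ℕ) : dixonTerm γ a b 1 = 1 := by
  simp [dixonTerm, genSigmaList, genSigma_one]

lemma dixonTerm_mul (γ : ℂ) (a b : ℕ) {m n : ℕ} (h : m.Coprime n) :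
    dixonTerm γ a b (m * n) = dixonTerm γ a b m * dixonTerm γ a b n := by
  simp only [dixonTerm, genSigmaList, List.map_cons, List.map_nil, List.prod_cons, List.prod_nil,
    genSigma_mul _ _ h, Nat.cast_mul, Complex.natCast_mul_natCast_cpow]
  rw [div_mul_div_comm]
  congr 1 <;> ring

lemma dixonTerm_prime_pow {p : ℕ} (hp : p.Prime) {γ : ℂ} (hγ : γ.re ≠ 0) {a : ℕ} (ha : 0 < a)
    (b n : ℕ) : dixonTerm γ a b (p ^ n) = localTerm ((p : ℂ) ^ (-γ)) a b n := by
  have hs : (-γ).re ≠ 0 := by simpa using hγ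
  have hs2 : (-(2 * γ)).re ≠ 0 := by simpa using hγ
  have e2 : (p : ℂ) ^ (-(2 * γ)) = ((p : ℂ) ^ (-γ)) ^ 2 := by
    rw [← Complex.cpow_nat_mul]; congr 1; push_cast; ring
  have ee : (((p ^ n : ℕ) : ℂ) ^ (((a + 1 - 2 * b : ℕ) : ℂ) * γ)) =
      (((p : ℂ) ^ (-γ)) ^ ((a + 1 - 2 * b) * n))⁻¹ := by
    rw [← Complex.cpow_nat_mul, ← Complex.cpow_neg, Nat.cast_pow,
      ← Complex.natCast_cpow_natCast_mul]
    congr 1; push_cast; ring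
  have hq := norm_prime_cpow_ne_one hp hs
  have hq2 : ‖((p : ℂ) ^ (-γ)) ^ 2‖ ≠ 1 := e2 ▸ norm_prime_cpow_ne_one hp hs2
  simp only [dixonTerm, genSigmaList, List.map_cons, List.map_nil, List.prod_cons, List.prod_nil,
    genSigma_prime_pow hp hs, genSigma_prime_pow hp hs2, e2, ee, localTerm]
  have hp0 : (p : ℂ) ^ (-γ) ≠ 0 := by simp [Complex.cpow_eq_zero_iff, hp.ne_zero]
  generalize (p : ℂ) ^ (-γ) = q at *
  obtain ⟨c, rfl⟩ : ∃ c, a = c + 1 := ⟨a - 1, by lia⟩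
  rw [show 1 + (c + 1) - 1 = c + 1 by lia, show c + 1 - 1 = c by lia, gaussCoeff_succ_left,
    gaussCoeff_succ_left, show 2 * (c + 1) + 1 - b - 1 = 2 * (c + 1) - b by lia]
  have h1 := gaussCoeff_ne_zero hq c n
  have h2 := gaussCoeff_ne_zero hq2 c n
  have h3 := gaussCoeff_ne_zero hq (2 * (c + 1) - b) n
  have h4 := one_sub_pow_ne_zero hq (n := c + 1) (by lia)
  have h5 := one_sub_pow_ne_zero hq (n := n + c + 1) (by lia)
  have h6 := one_add_pow_ne_zero hq (n := c + 1) (by lia)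
  have f (m : ℕ) : 1 - (q ^ 2) ^ m = (1 - q ^ m) * (1 + q ^ m) := by ring
  rw [f, f, ← add_assoc]
  field_simp

/-! ### Euler products of multiplicative functions -/

/-- A multiplicative function is absolutely summable as soon as the sum of its norms over all
nontrivial prime powers converges. -/
lemma summable_norm_of_summable_prime_pow {f : ℕ → ℂ} (hf0 : f 0 = 0) (hf1 : f 1 = 1)
    (hmul : ∀ {m n : ℕ}, m.Coprime n → f (m * n) = f m * f n)
    (hsum : ∀ {p : ℕ}, p.Prime → Summable fun n : ℕ => ‖f (p ^ n)‖)
    {g : ℕ → ℝ} (hg : Summable g) (hg0 : ∀ p, 0 ≤ g p)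
    (hfg : ∀ {p : ℕ}, p.Prime → ∑' n : ℕ, ‖f (p ^ (n + 1))‖ ≤ g p) :
    Summable fun n => ‖f n‖ := by
  refine summable_of_sum_le (c := Real.exp (∑' p, g p)) (fun _ => norm_nonneg _) fun u => ?_
  set N := u.sup id + 1
  obtain ⟨h1, h2⟩ := EulerProduct.summable_and_hasSum_smoothNumbers_prod_primesBelow_tsum
    (f := fun n => ‖f n‖) (by simp [hf1]) (fun h => by rw [hmul h, norm_mul])
    (fun hp => by simpa using hsum hp) N
  have h3 : ∑ n ∈ u, ‖f n‖ ≤ ∑' n : N.smoothNumbers, ‖f n‖ := by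
    rw [tsum_subtype N.smoothNumbers fun n => ‖f n‖]
    have h4 : ∀ n ∈ u, ‖f n‖ = N.smoothNumbers.indicator (fun n => ‖f n‖) n := by
      intro n hn
      rcases Nat.eq_zero_or_pos n with rfl | hn0
      · simp [hf0, Set.indicator_apply]
      · rw [Set.indicator_of_mem]
        exact Nat.mem_smoothNumbers_of_lt hn0 (Nat.lt_succ_of_le (Finset.le_sup (f := id) hn))
    rw [Finset.sum_congr rfl h4]
    refine Summable.sum_le_tsum _ (fun n _ => Set.indicator_nonneg (fun _ _ => norm_nonneg _) _) ?_
    exact summable_subtype_iff_indicator.mp h2.summable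
  refine h3.trans (h2.tsum_eq.le.trans ?_)
  calc ∏ p ∈ N.primesBelow, ∑' n : ℕ, ‖f (p ^ n)‖
      ≤ ∏ p ∈ N.primesBelow, (1 + g p) := by
        refine Finset.prod_le_prod (fun _ _ => tsum_nonneg fun _ => norm_nonneg _) fun p hp => ?_
        have hpp := Nat.prime_of_mem_primesBelow hp
        rw [(hsum hpp).tsum_eq_zero_add, pow_zero, hf1, norm_one]
        linarith [hfg hpp]
    _ ≤ Real.exp (∑ p ∈ N.primesBelow, g p) := Real.prod_one_add_le_exp_sum _ hg0
    _ ≤ Real.exp (∑' p, g p) := Real.exp_le_exp.mpr (hg.sum_le_tsum _ fun p _ => hg0 p)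

lemma norm_prime_cpow_neg {p : ℕ} (hp : p.Prime) (γ : ℂ) :
    ‖(p : ℂ) ^ (-γ)‖ = (p : ℝ) ^ (-γ.re) := by
  rw [Complex.norm_natCast_cpow_of_pos hp.pos, Complex.neg_re]

lemma norm_prime_cpow_neg_le {p : ℕ} (hp : p.Prime) {γ : ℂ} (hγ : 0 < γ.re) :
    ‖(p : ℂ) ^ (-γ)‖ ≤ (2 : ℝ) ^ (-γ.re) := by
  rw [norm_prime_cpow_neg hp]
  exact Real.rpow_le_rpow_of_nonpos two_pos (by exact_mod_cast hp.two_le) (by linarith)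

lemma two_rpow_neg_lt_one {x : ℝ} (hx : 0 < x) : (2 : ℝ) ^ (-x) < 1 :=
  Real.rpow_lt_one_of_one_lt_of_neg one_lt_two (by linarith)

/-- Absolute convergence: at the prime `p` the terms are bounded by a constant multiple of the
powers of `p ^ (-(a + 1 - 2b) γ)`, uniformly in `p`. -/
lemma summable_norm_dixonTerm {γ : ℂ} {a b : ℕ} (ha : 2 ≤ a) (hab : 2 * b ≤ a)
    (hγ : 1 < ((a + 1 - 2 * b : ℕ) : ℝ) * γ.re) : Summable fun k => ‖dixonTerm γ a b k‖ := by
  set e := a + 1 - 2 * b with he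
  have hγ0 : 0 < γ.re := by
    by_contra! h
    nlinarith [mul_nonpos_of_nonneg_of_nonpos (Nat.cast_nonneg (α := ℝ) e) h]
  have hr := two_rpow_neg_lt_one hγ0
  set r : ℝ := (2 : ℝ) ^ (-γ.re)
  have hr0 : 0 < 1 - r := by linarith
  have hsum {p : ℕ} (hp : p.Prime) : Summable fun n : ℕ => ‖dixonTerm γ a b (p ^ n)‖ := by
    simp only [dixonTerm_prime_pow hp hγ0.ne' (by lia : 0 < a)]
    exact summable_norm_localTerm ((norm_prime_cpow_neg_le hp hγ0).trans_lt hr) (by lia) hab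
  obtain ⟨C, hC0, hC⟩ : ∃ C : ℝ, 0 ≤ C ∧ ∀ q : ℂ, ‖q‖ ≤ r → ∀ n,
      ‖localTerm q a b n‖ ≤ C * ‖q‖ ^ (e * n) :=
    ⟨_, by positivity, fun q hq n => norm_localTerm_le hr hq (by lia) b n⟩
  refine summable_norm_of_summable_prime_pow (g := fun p => C * (1 - r)⁻¹ * (p : ℝ) ^ (-(e * γ.re)))
    (dixonTerm_zero γ ha) (dixonTerm_one γ a b) (dixonTerm_mul γ a b) hsum
    ((Real.summable_nat_rpow.mpr (by linarith)).mul_left _) (fun p => by positivity) fun {p} hp => ?_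
  have hq := norm_prime_cpow_neg_le hp hγ0
  have hqe : (p : ℝ) ^ (-(e * γ.re)) = ‖(p : ℂ) ^ (-γ)‖ ^ e := by
    rw [norm_prime_cpow_neg hp, ← Real.rpow_mul_natCast p.cast_nonneg]
    congr 1; ring
  set q := (p : ℂ) ^ (-γ)
  have hqr : ‖q‖ ^ e ≤ r := (pow_le_of_le_one (norm_nonneg q) (hq.trans hr.le) (by lia)).trans hq
  have hlt : ‖q‖ ^ e < 1 := hqr.trans_lt hr
  have hgeo := (hasSum_geometric_of_lt_one (by positivity) hlt).mul_left (C * ‖q‖ ^ e)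
  have hle : ∑' n : ℕ, ‖dixonTerm γ a b (p ^ (n + 1))‖ ≤ C * ‖q‖ ^ e * (1 - ‖q‖ ^ e)⁻¹ := by
    refine (Summable.tsum_le_tsum (fun n => ?_) ((summable_nat_add_iff 1).mpr (hsum hp))
      hgeo.summable).trans hgeo.tsum_eq.le
    rw [dixonTerm_prime_pow hp hγ0.ne' (by lia)]
    refine (hC q hq (n + 1)).trans_eq ?_
    rw [mul_add, mul_one, pow_add, pow_mul]
    ring
  refine hle.trans ?_
  rw [hqe, mul_right_comm]
  gcongr

/-! ### Local sums off the unit circle and sums over `S_m` -/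

lemma one_sub_inv_pow {q : ℂ} (hq : q ≠ 0) (n : ℕ) : 1 - q⁻¹ ^ n = -(1 - q ^ n) * (q ^ n)⁻¹ := by
  rw [inv_pow, neg_sub, sub_mul, mul_inv_cancel₀ (pow_ne_zero _ hq), one_mul]

/-- The local sum at `b = 1` off the unit circle: term and value are invariant under
`q ↦ q⁻¹`. -/
lemma hasSum_localTerm_one_of_norm_ne_one {q : ℂ} (hq0 : q ≠ 0) (hq : ‖q‖ ≠ 1) {a : ℕ}
    (ha : 2 ≤ a) :
    HasSum (localTerm q a 1)
      ((1 - q ^ a) * (1 - q ^ (2 * a - 1)) / ((1 - q ^ (2 * a)) * (1 - q ^ (a - 1)))) := by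
  rcases hq.lt_or_gt with h | h
  · exact hasSum_localTerm_one h ha
  · have h' := hasSum_localTerm_one (q := q⁻¹) (by rw [norm_inv]; exact inv_lt_one_of_one_lt₀ h) ha
    rw [show localTerm q⁻¹ a 1 = localTerm q a 1 from
      funext fun n => localTerm_inv hq0 one_pos (by lia) n] at h'
    convert h' using 1
    obtain ⟨d, rfl⟩ : ∃ d, a = d + 2 := ⟨a - 2, by lia⟩
    simp only [one_sub_inv_pow hq0]
    rw [show 2 * (d + 2) - 1 = 2 * d + 3 by lia, show d + 2 - 1 = d + 1 by lia]
    have h1 := one_sub_pow_ne_zero hq (n := 2 * (d + 2)) (by lia)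
    have h2 := one_sub_pow_ne_zero hq (n := d + 1) (by lia)
    field_simp
    ring

/-- The local sum at `b = 2` off the unit circle: term and value are invariant under
`q ↦ q⁻¹`. -/
lemma hasSum_localTerm_two_of_norm_ne_one {q : ℂ} (hq0 : q ≠ 0) (hq : ‖q‖ ≠ 1) {a : ℕ}
    (ha : 4 ≤ a) :
    HasSum (localTerm q a 2)
      ((1 - q ^ (2 * a - 3)) * (1 - q ^ (2 * a - 2)) * (1 - q ^ (a - 1)) * (1 - q ^ a) /
        ((1 - q ^ (2 * a - 1)) * (1 - q ^ (2 * a)) * (1 - q ^ (a - 3)) * (1 - q ^ (a - 2)))) := by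
  rcases hq.lt_or_gt with h | h
  · exact hasSum_localTerm_two h ha
  · have h' := hasSum_localTerm_two (q := q⁻¹) (by rw [norm_inv]; exact inv_lt_one_of_one_lt₀ h) ha
    rw [show localTerm q⁻¹ a 2 = localTerm q a 2 from
      funext fun n => localTerm_inv hq0 two_pos (by lia) n] at h'
    convert h' using 1
    obtain ⟨d, rfl⟩ : ∃ d, a = d + 4 := ⟨a - 4, by lia⟩
    simp only [one_sub_inv_pow hq0]
    rw [show 2 * (d + 4) - 3 = 2 * d + 5 by lia, show 2 * (d + 4) - 2 = 2 * d + 6 by lia,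
      show d + 4 - 1 = d + 3 by lia, show 2 * (d + 4) - 1 = 2 * d + 7 by lia,
      show d + 4 - 3 = d + 1 by lia, show d + 4 - 2 = d + 2 by lia]
    have h1 := one_sub_pow_ne_zero hq (n := 2 * (d + 4)) (by lia)
    have h2 := one_sub_pow_ne_zero hq (n := 2 * d + 7) (by lia)
    have h3 := one_sub_pow_ne_zero hq (n := d + 1) (by lia)
    have h4 := one_sub_pow_ne_zero hq (n := d + 2) (by lia)
    generalize 1 - q ^ (2 * (d + 4)) = x1, 1 - q ^ (2 * d + 7) = x2, 1 - q ^ (d + 1) = x3,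
      1 - q ^ (d + 2) = x4, 1 - q ^ (2 * d + 5) = x5, 1 - q ^ (2 * d + 6) = x6,
      1 - q ^ (d + 3) = x7, 1 - q ^ (d + 4) = x8 at *
    field_simp
    ring

lemma prime_cpow_ne_zero {p : ℕ} (hp : p.Prime) (s : ℂ) : (p : ℂ) ^ s ≠ 0 := by
  simp [Complex.cpow_eq_zero_iff, hp.ne_zero]

/-- The sum over `S_m` is the product of the local sums at the primes dividing `m`. -/
lemma hasSum_dixonTerm_primeSupported {γ : ℂ} (hγ : γ.re ≠ 0) {a b : ℕ} (ha : 0 < a) {R : ℂ → ℂ}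
    (hR : ∀ q : ℂ, q ≠ 0 → ‖q‖ ≠ 1 → HasSum (localTerm q a b) (R q)) (m : ℕ) :
    HasSum (fun k : primeSupported m => dixonTerm γ a b k)
      (∏ p ∈ m.primeFactors, R ((p : ℂ) ^ (-γ))) := by
  have key {p : ℕ} (hp : p.Prime) :
      HasSum (fun n : ℕ => dixonTerm γ a b (p ^ n)) (R ((p : ℂ) ^ (-γ))) := by
    simp only [dixonTerm_prime_pow hp hγ ha]
    exact hR _ (prime_cpow_ne_zero hp _) (norm_prime_cpow_ne_one hp (by simpa using hγ))
  have h := (EulerProduct.summable_and_hasSum_factoredNumbers_prod_filter_prime_tsum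
    (dixonTerm_one γ a b) (dixonTerm_mul γ a b) (fun hp => (key hp).summable.norm)
    m.primeFactors).2
  rw [Finset.filter_true_of_mem fun p hp => Nat.prime_of_mem_primeFactors hp] at h
  rwa [Finset.prod_congr rfl fun p hp => (key (Nat.prime_of_mem_primeFactors hp)).tsum_eq] at h

/-! ### Sums over all positive integers -/

lemma hasProd_riemannZeta_natCast_mul {γ : ℂ} {n : ℕ} (h : 1 < ((n : ℂ) * γ).re) :
    HasProd (fun p : Nat.Primes => (1 - ((p : ℂ) ^ (-γ)) ^ n)⁻¹) (riemannZeta (n * γ)) := by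
  convert riemannZeta_eulerProduct_hasProd h using 4 with p
  rw [← Complex.cpow_nat_mul, mul_neg]

/-- The sum over all positive integers is the Euler product of the local sums. -/
lemma hasSum_dixonTerm_pnat {γ : ℂ} {a b : ℕ} (ha : 2 ≤ a) (hab : 2 * b ≤ a)
    (hγ : 1 < ((a + 1 - 2 * b : ℕ) : ℝ) * γ.re) (hγ0 : γ.re ≠ 0) {R : ℂ → ℂ}
    (hR : ∀ q : ℂ, q ≠ 0 → ‖q‖ ≠ 1 → HasSum (localTerm q a b) (R q)) {Z : ℂ}
    (hZ : HasProd (fun p : Nat.Primes => R ((p : ℂ) ^ (-γ))) Z) :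
    HasSum (fun k : ℕ+ => dixonTerm γ a b k) Z := by
  have hs := summable_norm_dixonTerm ha hab hγ
  have h := EulerProduct.eulerProduct_hasProd (dixonTerm_one γ a b) (dixonTerm_mul γ a b) hs
    (dixonTerm_zero γ ha)
  have key (p : Nat.Primes) : ∑' n : ℕ, dixonTerm γ a b (p ^ n) = R ((p : ℂ) ^ (-γ)) := by
    simp only [dixonTerm_prime_pow p.2 hγ0 (by lia : 0 < a)]
    exact (hR _ (prime_cpow_ne_zero p.2 _)
      (norm_prime_cpow_ne_one p.2 (by simpa using hγ0))).tsum_eq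
  simp only [key] at h
  rw [hZ.unique h]
  refine (Function.Injective.hasSum_iff PNat.coe_injective fun n hn => ?_).mpr
    hs.of_norm.hasSum
  obtain rfl : n = 0 := by
    by_contra h0
    exact hn ⟨⟨n, Nat.pos_of_ne_zero h0⟩, rfl⟩
  exact dixonTerm_zero γ ha

/-! ### The infinite products of zeta values -/

/-- `ζ(s) - 1` decays like `2 ^ (-Re s)`, because every term of its series has base at least `2`. -/
lemma norm_riemannZeta_sub_one_le {s : ℂ} {σ : ℝ} (hσ : 1 < σ) (hs : σ ≤ s.re) :
    ‖riemannZeta s - 1‖ ≤ (∑' n : ℕ, ((n + 2 : ℕ) : ℝ) ^ (-σ)) * (2 : ℝ) ^ (-(s.re - σ)) := by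
  have hs1 : 1 < s.re := hσ.trans_le hs
  have h0 : Summable fun n : ℕ => 1 / (n : ℂ) ^ s := Complex.summable_one_div_nat_cpow.mpr hs1
  have hz : riemannZeta s - 1 = ∑' n : ℕ, 1 / ((n + 2 : ℕ) : ℂ) ^ s := by
    have hs0 : s ≠ 0 := Complex.ne_zero_of_one_lt_re hs1
    rw [zeta_eq_tsum_one_div_nat_cpow hs1, ← h0.sum_add_tsum_nat_add 2, Finset.sum_range_succ,
      Finset.sum_range_one]
    simp [Complex.zero_cpow hs0]
  have hsum : Summable fun n : ℕ => ((n + 2 : ℕ) : ℝ) ^ (-σ) :=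
    (summable_nat_add_iff 2 (f := fun n : ℕ => (n : ℝ) ^ (-σ))).mpr
      (Real.summable_nat_rpow.mpr (by linarith))
  rw [hz, ← tsum_mul_right]
  refine tsum_of_norm_bounded (hsum.mul_right _).hasSum fun n => ?_
  rw [norm_div, norm_one, Complex.norm_natCast_cpow_of_pos (by lia), one_div,
    ← Real.rpow_neg (Nat.cast_nonneg _), show -s.re = -σ + -(s.re - σ) by ring,
    Real.rpow_add (by positivity)]
  refine mul_le_mul_of_nonneg_left ?_ (by positivity)
  exact Real.rpow_le_rpow_of_nonpos two_pos (by exact_mod_cast Nat.le_add_left 2 n) (by linarith)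

lemma summable_norm_riemannZeta_sub_one {γ b : ℂ} (hγ : 0 < γ.re) (hb : 1 < (b * γ).re) :
    Summable fun k : ℕ => ‖riemannZeta ((b + k) * γ) - 1‖ := by
  have hre (k : ℕ) : ((b + k) * γ).re = (b * γ).re + k * γ.re := by
    rw [add_mul, Complex.add_re, ← Complex.ofReal_natCast, Complex.re_ofReal_mul]
  have hgeo : Summable fun k : ℕ => ((2 : ℝ) ^ (-γ.re)) ^ k :=
    summable_geometric_of_lt_one (by positivity) (two_rpow_neg_lt_one hγ)
  refine Summable.of_nonneg_of_le (fun _ => norm_nonneg _) (fun k => ?_)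
    (hgeo.mul_left (∑' n : ℕ, ((n + 2 : ℕ) : ℝ) ^ (-(b * γ).re)))
  refine (norm_riemannZeta_sub_one_le hb (by rw [hre]; nlinarith [k.cast_nonneg (α := ℝ)])).trans_eq
    ?_
  rw [hre, ← Real.rpow_mul_natCast two_pos.le]
  congr 2
  ring

lemma multipliable_riemannZeta {γ b : ℂ} (hγ : 0 < γ.re) (hb : 1 < (b * γ).re) :
    Multipliable fun k : ℕ => riemannZeta ((b + k) * γ) := by
  simpa using multipliable_one_add_of_summable (summable_norm_riemannZeta_sub_one hγ hb)

lemma zetaInf_ne_zero {γ b : ℂ} (hγ : 0 < γ.re) (hb : 1 < (b * γ).re) : zetaInf γ b ≠ 0 := by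
  have h := tprod_one_add_ne_zero_of_summable
    (f := fun k : ℕ => riemannZeta ((b + k) * γ) - 1) (fun k => ?_)
    (summable_norm_riemannZeta_sub_one hγ hb)
  · simpa [zetaInf] using h
  · rw [add_sub_cancel]
    refine riemannZeta_ne_zero_of_one_lt_re ?_
    rw [add_mul, Complex.add_re, ← Complex.ofReal_natCast, Complex.re_ofReal_mul]
    nlinarith [k.cast_nonneg (α := ℝ)]

lemma zetaInf_eq_mul {γ b c : ℂ} (hγ : 0 < γ.re) (hc : 1 < (c * γ).re) (h : b + 1 = c) :
    zetaInf γ b = riemannZeta (b * γ) * zetaInf γ c := by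
  subst h
  have e (k : ℕ) : b + ((k + 1 : ℕ) : ℂ) = b + 1 + k := by push_cast; ring
  rw [zetaInf, tprod_eq_zero_mul' (by simpa only [e] using multipliable_riemannZeta hγ hc)]
  simp only [e, Nat.cast_zero, add_zero, zetaInf]

lemma zetaInfList_one_eq {γ A : ℂ} (hγ : 0 < γ.re) (h0 : 1 < ((A - 1) * γ).re)
    (h1 : 1 < (A * γ).re) (h2 : 1 < ((A + 1) * γ).re) (h3 : 1 < ((2 * A - 1) * γ).re)
    (h4 : 1 < (2 * A * γ).re) (h5 : 1 < ((2 * A + 1) * γ).re) :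
    zetaInfList γ [2 * A, 2 * A, A + 1, A - 1] / zetaInfList γ [2 * A + 1, A, A, 2 * A - 1] =
      (riemannZeta (2 * A * γ) * riemannZeta ((A - 1) * γ)) /
        (riemannZeta (A * γ) * riemannZeta ((2 * A - 1) * γ)) := by
  simp only [zetaInfList, List.map_cons, List.map_nil, List.prod_cons, List.prod_nil, mul_one]
  rw [zetaInf_eq_mul hγ h1 (show A - 1 + 1 = A by ring),
    zetaInf_eq_mul hγ h2 (show A + 1 = _ from rfl),
    zetaInf_eq_mul hγ h4 (show 2 * A - 1 + 1 = 2 * A by ring),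
    zetaInf_eq_mul hγ h5 (show 2 * A + 1 = _ from rfl)]
  have n1 := zetaInf_ne_zero hγ h2
  have n2 := zetaInf_ne_zero hγ h5
  have n3 := riemannZeta_ne_zero_of_one_lt_re h0
  have n4 := riemannZeta_ne_zero_of_one_lt_re h1
  have n5 := riemannZeta_ne_zero_of_one_lt_re h3
  have n6 := riemannZeta_ne_zero_of_one_lt_re h4
  field_simp

lemma zetaInfList_two_eq {γ A : ℂ} (hγ : 0 < γ.re) (h0 : 1 < ((A - 3) * γ).re)
    (h1 : 1 < ((A - 2) * γ).re) (h2 : 1 < ((A - 1) * γ).re) (h3 : 1 < (A * γ).re)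
    (h4 : 1 < ((A + 1) * γ).re) (h5 : 1 < ((2 * A - 3) * γ).re) (h6 : 1 < ((2 * A - 2) * γ).re)
    (h7 : 1 < ((2 * A - 1) * γ).re) (h8 : 1 < (2 * A * γ).re) (h9 : 1 < ((2 * A + 1) * γ).re) :
    zetaInfList γ [2 * A - 1, 2 * A - 1, A + 1, A - 3] /
        zetaInfList γ [2 * A + 1, A - 1, A - 1, 2 * A - 3] =
      (riemannZeta ((2 * A - 1) * γ) * riemannZeta (2 * A * γ) * riemannZeta ((A - 3) * γ)
          * riemannZeta ((A - 2) * γ)) /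
        (riemannZeta ((2 * A - 3) * γ) * riemannZeta ((2 * A - 2) * γ)
          * riemannZeta ((A - 1) * γ) * riemannZeta (A * γ)) := by
  simp only [zetaInfList, List.map_cons, List.map_nil, List.prod_cons, List.prod_nil, mul_one]
  rw [zetaInf_eq_mul hγ h1 (show A - 3 + 1 = A - 2 by ring),
    zetaInf_eq_mul hγ h2 (show A - 2 + 1 = A - 1 by ring),
    zetaInf_eq_mul hγ h3 (show A - 1 + 1 = A by ring),
    zetaInf_eq_mul hγ h4 (show A + 1 = _ from rfl),
    zetaInf_eq_mul hγ h6 (show 2 * A - 3 + 1 = 2 * A - 2 by ring),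
    zetaInf_eq_mul hγ h7 (show 2 * A - 2 + 1 = 2 * A - 1 by ring),
    zetaInf_eq_mul hγ h8 (show 2 * A - 1 + 1 = 2 * A by ring),
    zetaInf_eq_mul hγ h9 (show 2 * A + 1 = _ from rfl)]
  have n1 := zetaInf_ne_zero hγ h4
  have n2 := zetaInf_ne_zero hγ h9
  have n3 := riemannZeta_ne_zero_of_one_lt_re h0
  have n4 := riemannZeta_ne_zero_of_one_lt_re h1
  have n5 := riemannZeta_ne_zero_of_one_lt_re h2
  have n6 := riemannZeta_ne_zero_of_one_lt_re h3
  have n7 := riemannZeta_ne_zero_of_one_lt_re h5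
  have n8 := riemannZeta_ne_zero_of_one_lt_re h6
  have n9 := riemannZeta_ne_zero_of_one_lt_re h7
  have n0 := riemannZeta_ne_zero_of_one_lt_re h8
  field_simp

/-! ### The two series -/

theorem mainTheorem2 (a : ℕ) (γ : ℂ) :
    -- First sum, over all `k ≥ 1`.
    (2 ≤ a → 1 < ((a : ℝ) - 1) * γ.re →
      (∀ b ∈ ([2 * a, a + 1, a - 1, 2 * a + 1, a, 2 * a - 1] : List ℂ),
        Multipliable fun k : ℕ => riemannZeta ((b + k) * γ)) ∧
      HasSum
        (fun k : ℕ+ =>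
          (genSigmaList (-γ) [2 * a, 1, 1] k * genSigma (-(2 * γ)) (1 + a) k
              * genSigma (-γ) a k) /
            (genSigmaList (-γ) [2 * a, 2 * a] k * genSigma (-(2 * γ)) a k
              * genSigma (-γ) (1 + a) k * (k : ℂ) ^ (((a : ℂ) - 1) * γ)))
        (zetaInfList γ [2 * a, 2 * a, a + 1, a - 1] /
          zetaInfList γ [2 * a + 1, a, a, 2 * a - 1]) ∧
      zetaInfList γ [2 * a, 2 * a, a + 1, a - 1] /
          zetaInfList γ [2 * a + 1, a, a, 2 * a - 1] =
        (riemannZeta (2 * a * γ) * riemannZeta ((a - 1) * γ)) /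
          (riemannZeta (a * γ) * riemannZeta ((2 * a - 1) * γ))) ∧
    -- First sum, over `k ∈ S_m`.
    (2 ≤ a → γ.re ≠ 0 → ∀ m : ℕ, 0 < m →
      HasSum
        (fun k : primeSupported m =>
          (genSigmaList (-γ) [2 * a, 1, 1] k * genSigma (-(2 * γ)) (1 + a) k
              * genSigma (-γ) a k) /
            (genSigmaList (-γ) [2 * a, 2 * a] k * genSigma (-(2 * γ)) a k
              * genSigma (-γ) (1 + a) k * ((k : ℕ) : ℂ) ^ (((a : ℂ) - 1) * γ)))
        ((sigmaC (-γ) (primePow m (a - 1)) * sigmaC (-γ) (primePow m (2 * a - 2))) /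
          (sigmaC (-γ) (primePow m (2 * a - 1)) * sigmaC (-γ) (primePow m (a - 2))))) ∧
    -- Second sum, over all `k ≥ 1`.
    (4 ≤ a → 1 < ((a : ℝ) - 3) * γ.re →
      (∀ b ∈ ([2 * a - 1, a + 1, a - 3, 2 * a + 1, a - 1, 2 * a - 3] : List ℂ),
        Multipliable fun k : ℕ => riemannZeta ((b + k) * γ)) ∧
      HasSum
        (fun k : ℕ+ =>
          (genSigmaList (-γ) [2 * a, 2, 2] k * genSigma (-(2 * γ)) (1 + a) k
              * genSigma (-γ) a k) /
            (genSigmaList (-γ) [2 * a - 1, 2 * a - 1] k * genSigma (-(2 * γ)) a k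
              * genSigma (-γ) (1 + a) k * (k : ℂ) ^ (((a : ℂ) - 3) * γ)))
        (zetaInfList γ [2 * a - 1, 2 * a - 1, a + 1, a - 3] /
          zetaInfList γ [2 * a + 1, a - 1, a - 1, 2 * a - 3]) ∧
      zetaInfList γ [2 * a - 1, 2 * a - 1, a + 1, a - 3] /
          zetaInfList γ [2 * a + 1, a - 1, a - 1, 2 * a - 3] =
        (riemannZeta ((2 * a - 1) * γ) * riemannZeta (2 * a * γ)
            * riemannZeta ((a - 3) * γ) * riemannZeta ((a - 2) * γ)) /
          (riemannZeta ((2 * a - 3) * γ) * riemannZeta ((2 * a - 2) * γ)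
            * riemannZeta ((a - 1) * γ) * riemannZeta (a * γ))) ∧
    -- Second sum, over `k ∈ S_m`.
    (4 ≤ a → γ.re ≠ 0 → ∀ m : ℕ, 0 < m →
      HasSum
        (fun k : primeSupported m =>
          (genSigmaList (-γ) [2 * a, 2, 2] k * genSigma (-(2 * γ)) (1 + a) k
              * genSigma (-γ) a k) /
            (genSigmaList (-γ) [2 * a - 1, 2 * a - 1] k * genSigma (-(2 * γ)) a k
              * genSigma (-γ) (1 + a) k * ((k : ℕ) : ℂ) ^ (((a : ℂ) - 3) * γ)))
        ((sigmaC (-γ) (primePow m (2 * a - 4)) * sigmaC (-γ) (primePow m (2 * a - 3))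
            * sigmaC (-γ) (primePow m (a - 2)) * sigmaC (-γ) (primePow m (a - 1))) /
          (sigmaC (-γ) (primePow m (2 * a - 2)) * sigmaC (-γ) (primePow m (2 * a - 1))
            * sigmaC (-γ) (primePow m (a - 4)) * sigmaC (-γ) (primePow m (a - 3))))) := by
  refine ⟨fun ha hγ => ?_, fun ha hγ m _ => ?_, fun ha hγ => ?_, fun ha hγ m _ => ?_⟩
  · have ha2 : (2 : ℝ) ≤ a := by exact_mod_cast ha
    have hγ0 : 0 < γ.re := by
      by_contra! h
      nlinarith [mul_nonpos_of_nonneg_of_nonpos (show (0 : ℝ) ≤ a - 1 by linarith) h]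
    -- Every zeta argument in sight is `x γ` with real `x ≥ a - 1`.
    have H (x : ℝ) (hx : (a : ℝ) - 1 ≤ x) : 1 < ((x : ℂ) * γ).re := by
      rw [Complex.re_ofReal_mul]
      nlinarith
    have h0 : 1 < (((a : ℂ) - 1) * γ).re := by exact_mod_cast H (a - 1) le_rfl
    have h1 : 1 < ((a : ℂ) * γ).re := by exact_mod_cast H a (by linarith)
    have h2 : 1 < (((a : ℂ) + 1) * γ).re := by exact_mod_cast H (a + 1) (by linarith)
    have h3 : 1 < ((2 * (a : ℂ) - 1) * γ).re := by exact_mod_cast H (2 * a - 1) (by linarith)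
    have h4 : 1 < (2 * (a : ℂ) * γ).re := by exact_mod_cast H (2 * a) (by linarith)
    have h5 : 1 < ((2 * (a : ℂ) + 1) * γ).re := by exact_mod_cast H (2 * a + 1) (by linarith)
    have hz := zetaInfList_one_eq hγ0 h0 h1 h2 h3 h4 h5
    refine ⟨?_, ?_, hz⟩
    · intro b hb
      refine multipliable_riemannZeta hγ0 ?_
      simp only [List.mem_cons, List.not_mem_nil, or_false] at hb
      rcases hb with rfl | rfl | rfl | rfl | rfl | rfl <;> assumption
    · rw [hz]
      have c0 : ((a - 1 : ℕ) : ℂ) = a - 1 := by rw [Nat.cast_sub (by lia), Nat.cast_one]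
      have c3 : ((2 * a - 1 : ℕ) : ℂ) = 2 * a - 1 := by
        rw [Nat.cast_sub (by lia)]; push_cast; ring
      have c4 : ((2 * a : ℕ) : ℂ) = 2 * a := by push_cast; ring
      have p0 := hasProd_riemannZeta_natCast_mul (γ := γ) (n := a - 1) (by rwa [c0])
      have p1 := hasProd_riemannZeta_natCast_mul (γ := γ) (n := a) h1
      have p3 := hasProd_riemannZeta_natCast_mul (γ := γ) (n := 2 * a - 1) (by rwa [c3])
      have p4 := hasProd_riemannZeta_natCast_mul (γ := γ) (n := 2 * a) (by rwa [c4])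
      rw [c0] at p0
      rw [c3] at p3
      rw [c4] at p4
      -- The Euler product of the quotient of zeta values has the local sums as its factors.
      have hZ := (p4.mul p0).div₀ (p1.mul p3) (mul_ne_zero
        (riemannZeta_ne_zero_of_one_lt_re h1) (riemannZeta_ne_zero_of_one_lt_re h3))
      have hγ' : 1 < ((a + 1 - 2 * 1 : ℕ) : ℝ) * γ.re := by
        rw [show a + 1 - 2 * 1 = a - 1 by lia, Nat.cast_sub (by lia), Nat.cast_one]
        exact hγ
      have h := hasSum_dixonTerm_pnat ha (by lia) hγ' hγ0.ne'
        (fun q hq0 hq => hasSum_localTerm_one_of_norm_ne_one hq0 hq ha)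
        (hZ.congr_fun fun p => by simp only [← mul_inv, inv_div_inv])
      simpa only [dixonTerm, show a + 1 - 2 * 1 = a - 1 by lia, c0, Nat.add_sub_cancel] using h
  · have hs : (-γ).re ≠ 0 := by simpa using hγ
    have h := hasSum_dixonTerm_primeSupported hγ (by lia : 0 < a)
      (fun q hq0 hq => hasSum_localTerm_one_of_norm_ne_one hq0 hq ha) m
    have c0 : ((a - 1 : ℕ) : ℂ) = a - 1 := by rw [Nat.cast_sub (by lia), Nat.cast_one]
    simp only [dixonTerm, show a + 1 - 2 * 1 = a - 1 by lia, c0, Nat.add_sub_cancel] at h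
    convert h using 1
    simp only [sigmaC_primePow hs, ← Finset.prod_mul_distrib, ← Finset.prod_div_distrib]
    refine Finset.prod_congr rfl fun p hp => ?_
    have hq := norm_prime_cpow_ne_one (Nat.prime_of_mem_primeFactors hp) hs
    have hq1 : 1 - (p : ℂ) ^ (-γ) ≠ 0 := by simpa using one_sub_pow_ne_zero hq one_ne_zero
    rw [show a - 1 + 1 = a by lia, show 2 * a - 2 + 1 = 2 * a - 1 by lia,
      show 2 * a - 1 + 1 = 2 * a by lia, show a - 2 + 1 = a - 1 by lia]
    field_simp
  · have ha2 : (4 : ℝ) ≤ a := by exact_mod_cast ha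
    have hγ0 : 0 < γ.re := by
      by_contra! h
      nlinarith [mul_nonpos_of_nonneg_of_nonpos (show (0 : ℝ) ≤ a - 3 by linarith) h]
    -- Every zeta argument in sight is `x γ` with real `x ≥ a - 3`.
    have H (x : ℝ) (hx : (a : ℝ) - 3 ≤ x) : 1 < ((x : ℂ) * γ).re := by
      rw [Complex.re_ofReal_mul]
      nlinarith
    have h0 : 1 < (((a : ℂ) - 3) * γ).re := by exact_mod_cast H (a - 3) le_rfl
    have h1 : 1 < (((a : ℂ) - 2) * γ).re := by exact_mod_cast H (a - 2) (by linarith)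
    have h2 : 1 < (((a : ℂ) - 1) * γ).re := by exact_mod_cast H (a - 1) (by linarith)
    have h3 : 1 < ((a : ℂ) * γ).re := by exact_mod_cast H a (by linarith)
    have h4 : 1 < (((a : ℂ) + 1) * γ).re := by exact_mod_cast H (a + 1) (by linarith)
    have h5 : 1 < ((2 * (a : ℂ) - 3) * γ).re := by exact_mod_cast H (2 * a - 3) (by linarith)
    have h6 : 1 < ((2 * (a : ℂ) - 2) * γ).re := by exact_mod_cast H (2 * a - 2) (by linarith)
    have h7 : 1 < ((2 * (a : ℂ) - 1) * γ).re := by exact_mod_cast H (2 * a - 1) (by linarith)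
    have h8 : 1 < (2 * (a : ℂ) * γ).re := by exact_mod_cast H (2 * a) (by linarith)
    have h9 : 1 < ((2 * (a : ℂ) + 1) * γ).re := by exact_mod_cast H (2 * a + 1) (by linarith)
    have hz := zetaInfList_two_eq hγ0 h0 h1 h2 h3 h4 h5 h6 h7 h8 h9
    refine ⟨?_, ?_, hz⟩
    · intro b hb
      refine multipliable_riemannZeta hγ0 ?_
      simp only [List.mem_cons, List.not_mem_nil, or_false] at hb
      rcases hb with rfl | rfl | rfl | rfl | rfl | rfl <;> assumption
    · rw [hz]
      have c (i : ℕ) (hi : i ≤ a) : ((a - i : ℕ) : ℂ) = a - i := Nat.cast_sub hi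
      have d (i : ℕ) (hi : i ≤ a) : ((2 * a - i : ℕ) : ℂ) = 2 * a - i := by
        rw [Nat.cast_sub (by lia)]; push_cast; ring
      have p0 := hasProd_riemannZeta_natCast_mul (γ := γ) (n := a - 3)
        (by rw [c 3 (by lia)]; exact_mod_cast h0)
      have p1 := hasProd_riemannZeta_natCast_mul (γ := γ) (n := a - 2)
        (by rw [c 2 (by lia)]; exact_mod_cast h1)
      have p2 := hasProd_riemannZeta_natCast_mul (γ := γ) (n := a - 1)
        (by rw [c 1 (by lia)]; exact_mod_cast h2)
      have p3 := hasProd_riemannZeta_natCast_mul (γ := γ) (n := a) h3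
      have p5 := hasProd_riemannZeta_natCast_mul (γ := γ) (n := 2 * a - 3)
        (by rw [d 3 (by lia)]; exact_mod_cast h5)
      have p6 := hasProd_riemannZeta_natCast_mul (γ := γ) (n := 2 * a - 2)
        (by rw [d 2 (by lia)]; exact_mod_cast h6)
      have p7 := hasProd_riemannZeta_natCast_mul (γ := γ) (n := 2 * a - 1)
        (by rw [d 1 (by lia)]; exact_mod_cast h7)
      have p8 := hasProd_riemannZeta_natCast_mul (γ := γ) (n := 2 * a)
        (by push_cast; exact h8)
      -- The Euler product of the quotient of zeta values has the local sums as its factors.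
      have hZ := (((p7.mul p8).mul p0).mul p1).div₀ (((p5.mul p6).mul p2).mul p3) ?_
      · have hγ' : 1 < ((a + 1 - 2 * 2 : ℕ) : ℝ) * γ.re := by
          rw [show a + 1 - 2 * 2 = a - 3 by lia, Nat.cast_sub (by lia)]
          exact_mod_cast hγ
        have h := hasSum_dixonTerm_pnat (by lia) (by lia) hγ' hγ0.ne'
          (fun q hq0 hq => hasSum_localTerm_two_of_norm_ne_one hq0 hq ha)
          (hZ.congr_fun fun p => by simp only [← mul_inv, inv_div_inv])
        simpa only [dixonTerm, show a + 1 - 2 * 2 = a - 3 by lia,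
          show 2 * a + 1 - 2 = 2 * a - 1 by lia, c 1 (by lia), c 2 (by lia), c 3 (by lia),
          d 1 (by lia), d 2 (by lia), d 3 (by lia), Nat.cast_mul, Nat.cast_ofNat,
          Nat.cast_one] using h
      · rw [d 3 (by lia), d 2 (by lia), c 1 (by lia)]
        push_cast
        exact mul_ne_zero (mul_ne_zero (mul_ne_zero (riemannZeta_ne_zero_of_one_lt_re h5)
          (riemannZeta_ne_zero_of_one_lt_re h6)) (riemannZeta_ne_zero_of_one_lt_re h2))
          (riemannZeta_ne_zero_of_one_lt_re h3)
  · have hs : (-γ).re ≠ 0 := by simpa using hγ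
    have h := hasSum_dixonTerm_primeSupported hγ (by lia : 0 < a)
      (fun q hq0 hq => hasSum_localTerm_two_of_norm_ne_one hq0 hq ha) m
    have c0 : ((a - 3 : ℕ) : ℂ) = a - 3 := by rw [Nat.cast_sub (by lia), Nat.cast_ofNat]
    simp only [dixonTerm, show a + 1 - 2 * 2 = a - 3 by lia, c0,
      show 2 * a + 1 - 2 = 2 * a - 1 by lia] at h
    convert h using 1
    simp only [sigmaC_primePow hs, ← Finset.prod_mul_distrib, ← Finset.prod_div_distrib]
    refine Finset.prod_congr rfl fun p hp => ?_
    have hq := norm_prime_cpow_ne_one (Nat.prime_of_mem_primeFactors hp) hs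
    have hq1 : 1 - (p : ℂ) ^ (-γ) ≠ 0 := by simpa using one_sub_pow_ne_zero hq one_ne_zero
    rw [show 2 * a - 4 + 1 = 2 * a - 3 by lia, show 2 * a - 3 + 1 = 2 * a - 2 by lia,
      show a - 2 + 1 = a - 1 by lia, show a - 1 + 1 = a by lia,
      show 2 * a - 2 + 1 = 2 * a - 1 by lia, show 2 * a - 1 + 1 = 2 * a by lia,
      show a - 4 + 1 = a - 3 by lia, show a - 3 + 1 = a - 2 by lia]
    field_simp
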